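/- Let $K$ be a field, $n\ge m\ge 1$ and $t\ge 1$ integers, and $S=K[x_1,\ldots,x_n]$ with its $\mathbb Z^n$-grading. Let $$I_{n,m}=(x_1x_2\cdots x_m,\;x_2x_3\cdots x_{m+1},\;\ldots,\;x_{n-m+1}\cdots x_n)\subset S$$ be the $m$-path ideal of the path graph on $n$ vertices, and put $t_0=\min\{t,n-m\}$. For a nonzero monomial ideal $I\subset S$, a Stanley decomposition of $I$ is a finite direct sum decomposition $\mathcal D: I=\bigoplus_{i=1}^r u_iK[Z_i]$ of $K$-vector spaces, where each $u_i\in I$ is nonzero and homogeneous for the $\mathbb Z^n$-grading (a nonzero scalar times a monomial) and $Z_i\subset\{x_1,\ldots,x_n\}$. Put $\operatorname{sdepth}(\mathcal D)=\min_i|Z_i|$, and let the Stanley depth $\operatorname{sdepth}(I)$ be the maximum of $\operatorname{sdepth}(\mathcal D)$ over all Stanley decompositions $\mathcal D$ of $I$. Then $$\operatorname{sdepth}(I_{n,m}^t)\;\le\;\min\left\{\,n-\left\lceil\frac{t_0}{2}\right\rceil,\;\; n-\left\lfloor\frac{n-t_0+1}{m+1}\right\rfloor+1\right\}.$$ -/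

import Mathlib

/-- The `K`-subspace `u K[Z] = {u p : p ∈ K[Z]}` of `K[x_i : i ∈ σ]`, where `K[Z]` is the polynomial
ring in the variables `x_j`, `j ∈ Z`. -/
noncomputable def stanleySpace {σ K : Type*} [Field K] (u : MvPolynomial σ K) (Z : Finset σ) :
    Submodule K (MvPolynomial σ K) :=
  (Subalgebra.toSubmodule (MvPolynomial.supported K (Z : Set σ))).map (LinearMap.mulLeft K u)

/-- A Stanley decomposition `I = u_1 K[Z_1] ⊕ ⋯ ⊕ u_r K[Z_r]` of an ideal `I` of the polynomial ring
`K[x_i : i ∈ σ]`, with its fine (one degree per variable) grading. The nonzero homogeneous elements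
of this grading are the terms `c x^a` with `c ≠ 0`. As the polynomial ring is a domain, `u K[Z]` is a
free `K[Z]`-module exactly when `u ≠ 0`. -/
structure StanleyDecomposition {σ K : Type*} [Field K] (I : Ideal (MvPolynomial σ K)) where
  /-- the number of summands -/
  r : ℕ
  /-- the homogeneous generators -/
  u : Fin r → MvPolynomial σ K
  /-- the sets of variables -/
  Z : Fin r → Finset σ
  mem : ∀ i, u i ∈ I
  homogeneous : ∀ i, ∃ (a : σ →₀ ℕ) (c : K), c ≠ 0 ∧ u i = MvPolynomial.monomial a c
  independent : iSupIndep fun i => stanleySpace (u i) (Z i)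
  sum_eq : ⨆ i, stanleySpace (u i) (Z i) = I.restrictScalars K

/-- The Stanley depth `min_i |Z_i|` of a Stanley decomposition (of a nonzero ideal, so that the
decomposition has at least one summand). -/
noncomputable def StanleyDecomposition.sdepth {σ K : Type*} [Field K]
    {I : Ideal (MvPolynomial σ K)} (D : StanleyDecomposition I) : ℕ :=
  ⨅ i, (D.Z i).card

/-- The values `D.sdepth` are bounded by the number of variables, so that the supremum defining the
Stanley depth of an ideal is a maximum whenever a Stanley decomposition exists. -/
theorem StanleyDecomposition.bddAbove_sdepth {σ K : Type*} [Fintype σ] [Field K]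
    (I : Ideal (MvPolynomial σ K)) :
    BddAbove (Set.range fun D : StanleyDecomposition I => D.sdepth) := by
  refine ⟨Fintype.card σ, ?_⟩
  rintro _ ⟨D, rfl⟩
  show (⨅ i, (D.Z i).card) ≤ _
  rcases isEmpty_or_nonempty (Fin D.r) with h | ⟨⟨i⟩⟩
  · simp
  · exact (ciInf_le (OrderBot.bddBelow _) i).trans (Finset.card_le_univ _)

/-- The Stanley depth of a (nonzero monomial) ideal `I`, regarded as a multigraded module: the
maximum of the Stanley depths of its Stanley decompositions. -/
noncomputable def stanleyDepth {σ K : Type*} [Field K] (I : Ideal (MvPolynomial σ K)) : ℕ :=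
  ⨆ D : StanleyDecomposition I, D.sdepth

/-- The `m`-path ideal `I_{n,m}` of the path graph on `n` vertices: it is generated by the products
of `m` consecutive variables. The variables `x_1, …, x_n` are indexed by `Fin n` (from `0`), and the
generator that starts at position `i` is `x_i x_{i+1} ⋯ x_{i+m-1}`. -/
noncomputable def pathIdeal (K : Type*) [Field K] (n m : ℕ) : Ideal (MvPolynomial (Fin n) K) :=
  Ideal.span {f | ∃ i : ℕ, i + m ≤ n ∧
    f = ∏ k ∈ (Finset.univ : Finset (Fin n)).filter (fun k => i ≤ k.val ∧ k.val < i + m),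
      MvPolynomial.X k}

/-!
The summands of a Stanley decomposition of a monomial ideal `I` partition the monomials of `I`, and
each summand is closed under greatest common divisors. Hence, if `x^v ∉ I` while `x^v x_j` and
`x^v x_k` lie in `I`, it cannot happen that `x_k` is free in the summand of `x^v x_j` and also
`x_j` is free in the summand of `x^v x_k`.

Let now `C_1, …, C_q` be disjoint sets of variables and `w` a monomial such that `w y_1 ⋯ y_q ∈ I`
for all `y_i ∈ C_i`, whereas `I` contains none of the quotients of these products by a `y_i`.
Averaging over the transversals `(y_1, …, y_q)` yields one at which at least half of the
`∑ (|C_i| - 1)` exchanges are in non-free variables, so `2 sdepth I + ∑ |C_i| ≤ 2n + q`.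

For the powers of the path ideal this is applied in two ways:
* with `C_i` the residue classes modulo `m` in the first `t₀ + m` vertices;
* with a single set `C`, a minimal vertex cover by `2 ⌊n / (m + 1)⌋` or more vertices.
-/

open Finset MvPolynomial

theorem card_add_sum_card_sdiff_le {σ ι : Type*} [Fintype σ] [DecidableEq σ] [Fintype ι]
    {A : ι → Finset σ} (hA : Pairwise (Function.onFun Disjoint A)) (Z : Finset σ) :
    #Z + ∑ i, #(A i \ Z) ≤ Fintype.card σ := by
  rw [← card_biUnion fun i _ j _ hij => (hA hij).mono sdiff_subset sdiff_subset,
    ← card_union_of_disjoint]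
  · exact card_le_univ _
  · exact (disjoint_biUnion_right _ _ _).2 fun _ _ => disjoint_sdiff

theorem sum_update_add {ι α M : Type*} [Fintype ι] [DecidableEq ι] [AddCommMonoid M] (F : α → M)
    (f : ι → α) (i : ι) (a : α) :
    ∑ l, F (Function.update f i a l) + F (f i) = ∑ l, F (f l) + F a := by
  rw [← sum_erase_add univ (fun l => F (Function.update f i a l)) (mem_univ i),
    ← sum_erase_add univ (fun l => F (f l)) (mem_univ i), Function.update_self, add_right_comm]
  congr 2
  exact sum_congr rfl fun l hl => by rw [Function.update_of_ne (ne_of_mem_erase hl)]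

section Transversals

variable {ι : Type*} {α : ι → Type*} [Fintype ι] [DecidableEq ι] [∀ i, DecidableEq (α i)]

theorem sum_piFinset_sum_erase_update {M : Type*} [AddCommMonoid M] (C : ∀ i, Finset (α i))
    (i : ι) (F : (∀ i, α i) → α i → M) :
    ∑ f ∈ Fintype.piFinset C, ∑ j ∈ (C i).erase (f i), F (Function.update f i j) (f i) =
      ∑ f ∈ Fintype.piFinset C, ∑ j ∈ (C i).erase (f i), F f j := by
  have swap_mem : ∀ x ∈ (Fintype.piFinset C).sigma fun f => (C i).erase (f i),
      (⟨Function.update x.1 i x.2, x.1 i⟩ : Σ _ : ∀ i, α i, α i) ∈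
        (Fintype.piFinset C).sigma fun f => (C i).erase (f i) := by
    rintro ⟨f, j⟩ h
    simp only [mem_sigma, Fintype.mem_piFinset, mem_erase] at h ⊢
    obtain ⟨hf, hne, hj⟩ := h
    refine ⟨fun l => ?_, by simpa using hne.symm, hf i⟩
    rcases eq_or_ne l i with rfl | hl
    · simpa using hj
    · simpa [hl] using hf l
  rw [sum_sigma', sum_sigma']
  exact sum_nbij' (fun x => ⟨Function.update x.1 i x.2, x.1 i⟩)
    (fun x => ⟨Function.update x.1 i x.2, x.1 i⟩) swap_mem swap_mem (by simp) (by simp) (by simp)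

theorem exists_sum_card_erase_le_two_mul {C : ∀ i, Finset (α i)} (hC : ∀ i, (C i).Nonempty)
    {Z : (∀ i, α i) → ∀ i, Finset (α i)}
    (hZ : ∀ f ∈ Fintype.piFinset C, ∀ i, ∀ j ∈ (C i).erase (f i),
      j ∈ Z f i → f i ∉ Z (Function.update f i j) i) :
    ∃ f ∈ Fintype.piFinset C,
      ∑ i, #((C i).erase (f i)) ≤ 2 * ∑ i, #((C i).erase (f i) \ Z f i) := by
  refine exists_le_of_sum_le (Fintype.piFinset_nonempty.2 hC) ?_
  rw [← mul_sum, sum_comm, sum_comm (s := Fintype.piFinset C), mul_sum]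
  refine sum_le_sum fun i _ => ?_
  let F : (∀ i, α i) → α i → ℕ := fun f j => if j ∉ Z f i then 1 else 0
  have card_eq : ∀ f, #((C i).erase (f i) \ Z f i) = ∑ j ∈ (C i).erase (f i), F f j := fun f => by
    rw [sdiff_eq_filter, card_filter]
  calc ∑ f ∈ Fintype.piFinset C, #((C i).erase (f i))
      = ∑ f ∈ Fintype.piFinset C, ∑ j ∈ (C i).erase (f i), 1 := by simp only [card_eq_sum_ones]
    _ ≤ ∑ f ∈ Fintype.piFinset C,
          ∑ j ∈ (C i).erase (f i), (F f j + F (Function.update f i j) (f i)) := by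
        refine sum_le_sum fun f hf => sum_le_sum fun j hj => ?_
        by_cases hjZ : j ∈ Z f i
        · simp [F, hZ f hf i j hj hjZ]
        · simp [F, hjZ]
    _ = 2 * ∑ f ∈ Fintype.piFinset C, #((C i).erase (f i) \ Z f i) := by
        simp only [sum_add_distrib, sum_piFinset_sum_erase_update, card_eq, two_mul]

end Transversals

section StanleyExponents

variable {σ : Type*}

/-- The set of exponents of the monomials in the Stanley space `x^a K[Z]`. -/
def stanleyExponents (a : σ →₀ ℕ) (Z : Finset σ) : Set (σ →₀ ℕ) :=
  {b | a ≤ b ∧ ∀ k ∉ Z, b k = a k}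

theorem inf_mem_stanleyExponents {a b c : σ →₀ ℕ} {Z : Finset σ} (hb : b ∈ stanleyExponents a Z)
    (hc : c ∈ stanleyExponents a Z) : b ⊓ c ∈ stanleyExponents a Z :=
  ⟨le_inf hb.1 hc.1, fun k hk => by rw [Finsupp.inf_apply, hb.2 k hk, hc.2 k hk, min_self]⟩

theorem add_single_mem_stanleyExponents {a b : σ →₀ ℕ} {Z : Finset σ} {k : σ}
    (hb : b ∈ stanleyExponents a Z) (hk : k ∈ Z) (c : ℕ) :
    b + Finsupp.single k c ∈ stanleyExponents a Z := by
  refine ⟨hb.1.trans le_self_add, fun l hl => ?_⟩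
  have hkl : l ≠ k := fun h => hl (h ▸ hk)
  rw [Finsupp.add_apply, Finsupp.single_eq_of_ne hkl, add_zero, hb.2 l hl]

theorem stanleySpace_monomial {K : Type*} [Field K] (a : σ →₀ ℕ) {c : K} (hc : c ≠ 0)
    (Z : Finset σ) :
    stanleySpace (monomial a c) Z = restrictSupport K (stanleyExponents a Z) := by
  classical
  apply le_antisymm
  · rintro _ ⟨p, hp, rfl⟩ b hb
    change b ∈ (monomial a c * p).support at hb
    rw [mem_support_iff, coeff_monomial_mul'] at hb
    split_ifs at hb with hab
    · refine ⟨hab, fun k hk => by_contra fun hne => hk ?_⟩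
      have hba : b - a ∈ p.support := mem_support_iff.2 (right_ne_zero_of_mul hb)
      refine mem_supported.1 hp ((mem_vars_iff_mem_support k).2 ⟨b - a, hba, ?_⟩)
      have hak : a k ≤ b k := hab k
      rw [Finsupp.mem_support_iff, Finsupp.tsub_apply]
      omega
    · exact absurd rfl hb
  · rw [restrictSupport_eq_span, Submodule.span_le]
    rintro _ ⟨b, ⟨hab, hb⟩, rfl⟩
    refine ⟨monomial (b - a) c⁻¹, mem_supported.2 fun k hk => by_contra fun hkZ => ?_, ?_⟩
    · rw [vars_monomial (inv_ne_zero hc), mem_coe, Finsupp.mem_support_iff, Finsupp.tsub_apply,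
        hb k hkZ, tsub_self] at hk
      exact hk rfl
    · rw [LinearMap.mulLeft_apply, monomial_mul, mul_inv_cancel₀ hc, add_tsub_cancel_of_le hab]

end StanleyExponents

namespace StanleyDecomposition

variable {σ K : Type*} [Field K] {I : Ideal (MvPolynomial σ K)} (D : StanleyDecomposition I)

/-- The set of exponents of the monomials in the `p`-th summand of a Stanley decomposition. -/
def block (p : Fin D.r) : Set (σ →₀ ℕ) :=
  {b | monomial b 1 ∈ stanleySpace (D.u p) (D.Z p)}

theorem exists_block_eq_stanleyExponents (p : Fin D.r) :
    ∃ a, D.block p = stanleyExponents a (D.Z p) := by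
  obtain ⟨a, c, hc, hu⟩ := D.homogeneous p
  refine ⟨a, Set.ext fun b => ?_⟩
  simp [block, hu, stanleySpace_monomial a hc]

theorem stanleySpace_eq_restrictSupport_block (p : Fin D.r) :
    stanleySpace (D.u p) (D.Z p) = restrictSupport K (D.block p) := by
  obtain ⟨a, c, hc, hu⟩ := D.homogeneous p
  have hspace := stanleySpace_monomial a hc (D.Z p)
  rw [← hu] at hspace
  rw [hspace]
  congr 1
  ext b
  simp [block, hspace]

theorem exists_mem_block_iff {b : σ →₀ ℕ} : (∃ p, b ∈ D.block p) ↔ monomial b 1 ∈ I := by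
  rw [← Submodule.restrictScalars_mem K I, ← D.sum_eq]
  constructor
  · rintro ⟨p, hp⟩
    exact Submodule.mem_iSup_of_mem p hp
  · intro hb
    have hle : ⨆ p, stanleySpace (D.u p) (D.Z p) ≤ restrictSupport K (⋃ p, D.block p) :=
      iSup_le fun p => (D.stanleySpace_eq_restrictSupport_block p).trans_le
        (restrictSupport_mono K (Set.subset_iUnion _ p))
    simpa using hle hb

theorem eq_of_mem_block {b : σ →₀ ℕ} {p q : Fin D.r} (hp : b ∈ D.block p) (hq : b ∈ D.block q) :
    p = q := by
  by_contra hne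
  have hzero := Submodule.disjoint_def.1 (D.independent.pairwiseDisjoint hne) _ hp hq
  exact one_ne_zero (monomial_eq_zero.1 hzero)

open scoped Classical in
/-- The set `Z_p` of the unique summand `u_p K[Z_p]` containing `x^b`; the junk value `∅` if `x^b`
does not lie in `I`. -/
noncomputable def directions (b : σ →₀ ℕ) : Finset σ :=
  if h : ∃ p, b ∈ D.block p then D.Z h.choose else ∅

theorem directions_eq {b : σ →₀ ℕ} {p : Fin D.r} (hb : b ∈ D.block p) :
    D.directions b = D.Z p := by
  have h : ∃ p, b ∈ D.block p := ⟨p, hb⟩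
  rw [directions, dif_pos h, D.eq_of_mem_block h.choose_spec hb]

theorem sdepth_le_card_directions {b : σ →₀ ℕ} (hb : monomial b 1 ∈ I) :
    D.sdepth ≤ #(D.directions b) := by
  obtain ⟨p, hp⟩ := D.exists_mem_block_iff.2 hb
  rw [D.directions_eq hp]
  exact ciInf_le (OrderBot.bddBelow _) p

/- Otherwise `x^v x_j x_k` lies in the summands of both `x^v x_j` and `x^v x_k`, so these summands
agree; but a summand is closed under greatest common divisors, and would contain `x^v`. -/
theorem notMem_directions_of_mem_directions {v : σ →₀ ℕ} {j k : σ} (hv : monomial v 1 ∉ I)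
    (hjI : monomial (v + Finsupp.single j 1) 1 ∈ I)
    (hkI : monomial (v + Finsupp.single k 1) 1 ∈ I) (hjk : j ≠ k)
    (hk : k ∈ D.directions (v + Finsupp.single j 1)) :
    j ∉ D.directions (v + Finsupp.single k 1) := by
  intro hj
  obtain ⟨p, hp⟩ := D.exists_mem_block_iff.2 hjI
  obtain ⟨q, hq⟩ := D.exists_mem_block_iff.2 hkI
  rw [D.directions_eq hp] at hk
  rw [D.directions_eq hq] at hj
  obtain ⟨a, ha⟩ := D.exists_block_eq_stanleyExponents p
  obtain ⟨a', ha'⟩ := D.exists_block_eq_stanleyExponents q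
  have hpq : p = q := by
    refine D.eq_of_mem_block (b := v + Finsupp.single j 1 + Finsupp.single k 1) ?_ ?_
    · rw [ha] at hp ⊢
      exact add_single_mem_stanleyExponents hp hk 1
    · rw [ha'] at hq
      rw [ha', add_right_comm]
      exact add_single_mem_stanleyExponents hq hj 1
  subst hpq
  refine hv (D.exists_mem_block_iff.1 ⟨p, ?_⟩)
  have hinf : v = (v + Finsupp.single j 1) ⊓ (v + Finsupp.single k 1) := by
    classical
    ext l
    simp only [Finsupp.inf_apply, Finsupp.add_apply, Finsupp.single_apply]
    split_ifs with hjl hkl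
    · exact absurd (hjl.trans hkl.symm) hjk
    all_goals simp
  rw [ha] at hp hq ⊢
  rw [hinf]
  exact inf_mem_stanleyExponents hp hq

theorem notMem_directions_update {ι : Type*} [Fintype ι] [DecidableEq ι] {C : ι → Finset σ}
    {w : σ →₀ ℕ}
    (hin : ∀ f : ι → σ, (∀ i, f i ∈ C i) → monomial (w + ∑ i, Finsupp.single (f i) 1) 1 ∈ I)
    (hout : ∀ f : ι → σ, (∀ i, f i ∈ C i) → ∀ i,
      monomial (w + ∑ l ∈ univ.erase i, Finsupp.single (f l) 1) 1 ∉ I)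
    {f : ι → σ} (hf : ∀ i, f i ∈ C i) {i : ι} {j : σ} (hj : j ∈ C i) (hjf : j ≠ f i)
    (hjD : j ∈ D.directions (w + ∑ l, Finsupp.single (f l) 1)) :
    f i ∉ D.directions (w + ∑ l, Finsupp.single (Function.update f i j l) 1) := by
  have hsplit : w + ∑ l, Finsupp.single (f l) 1 =
      w + ∑ l ∈ univ.erase i, Finsupp.single (f l) 1 + Finsupp.single (f i) 1 := by
    rw [add_assoc, sum_erase_add _ _ (mem_univ i)]
  have hsplit' : w + ∑ l, Finsupp.single (Function.update f i j l) 1 =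
      w + ∑ l ∈ univ.erase i, Finsupp.single (f l) 1 + Finsupp.single j 1 := by
    refine add_right_cancel (b := Finsupp.single (f i) 1) ?_
    rw [add_assoc, sum_update_add fun k => Finsupp.single k 1, ← add_assoc, hsplit, add_right_comm]
  have hupdate : ∀ l, Function.update f i j l ∈ C l :=
    (Function.forall_update_iff f fun l k => k ∈ C l).2 ⟨hj, fun l _ => hf l⟩
  have hfI := hin f hf
  have hfI' := hin _ hupdate
  rw [hsplit] at hfI hjD
  rw [hsplit'] at hfI' ⊢
  exact D.notMem_directions_of_mem_directions (hout f hf i) hfI hfI' hjf.symm hjD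

theorem two_mul_sdepth_add_sum_card_le [Fintype σ] {ι : Type*} [Fintype ι] [DecidableEq ι]
    {C : ι → Finset σ} (hdisj : Pairwise (Function.onFun Disjoint C))
    (hne : ∀ i, (C i).Nonempty) (w : σ →₀ ℕ)
    (hin : ∀ f : ι → σ, (∀ i, f i ∈ C i) → monomial (w + ∑ i, Finsupp.single (f i) 1) 1 ∈ I)
    (hout : ∀ f : ι → σ, (∀ i, f i ∈ C i) → ∀ i,
      monomial (w + ∑ l ∈ univ.erase i, Finsupp.single (f l) 1) 1 ∉ I) :
    2 * D.sdepth + ∑ i, #(C i) ≤ 2 * Fintype.card σ + Fintype.card ι := by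
  classical
  let b : (ι → σ) → σ →₀ ℕ := fun f => w + ∑ i, Finsupp.single (f i) 1
  obtain ⟨f, hf, hcard⟩ := exists_sum_card_erase_le_two_mul hne
    (Z := fun f _ => D.directions (b f)) fun f hf i j hj hjD =>
      D.notMem_directions_update hin hout (Fintype.mem_piFinset.1 hf) (mem_of_mem_erase hj)
        (ne_of_mem_erase hj) hjD
  rw [Fintype.mem_piFinset] at hf
  have hle := card_add_sum_card_sdiff_le (A := fun i => (C i).erase (f i))
    (fun i j hij => (hdisj hij).mono (erase_subset _ _) (erase_subset _ _)) (D.directions (b f))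
  have hsum : ∑ i, #(C i) = ∑ i, #((C i).erase (f i)) + Fintype.card ι := by
    rw [Fintype.card_eq_sum_ones, ← sum_add_distrib]
    exact sum_congr rfl fun i _ => (card_erase_add_one (hf i)).symm
  have hsdepth : D.sdepth ≤ #(D.directions (b f)) := D.sdepth_le_card_directions (hin f hf)
  omega

end StanleyDecomposition


section MonomialIdeals

variable {σ R : Type*} [CommSemiring R]

theorem monomial_mem_of_le {I : Ideal (MvPolynomial σ R)} {a b : σ →₀ ℕ}
    (ha : monomial a 1 ∈ I) (hab : a ≤ b) : monomial b 1 ∈ I :=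
  I.mem_of_dvd (monomial_dvd_monomial.2 ⟨Or.inr hab, one_dvd 1⟩) ha

theorem monomial_add_mem_pow {I : Ideal (MvPolynomial σ R)} {a b : σ →₀ ℕ} {s t : ℕ}
    (ha : monomial a 1 ∈ I ^ s) (hb : monomial b 1 ∈ I ^ t) :
    monomial (a + b) 1 ∈ I ^ (s + t) := by
  rw [pow_add, ← mul_one (1 : R), ← monomial_mul]
  exact Ideal.mul_mem_mul ha hb

theorem monomial_nsmul_mem_pow {I : Ideal (MvPolynomial σ R)} {a : σ →₀ ℕ}
    (ha : monomial a 1 ∈ I) (s : ℕ) : monomial (s • a) 1 ∈ I ^ s := by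
  rw [← one_pow (M := R) s, ← monomial_pow]
  exact Ideal.pow_mem_pow ha s

/-- The exponent of the squarefree monomial `∏ k ∈ A, x_k`. -/
noncomputable def squarefreeExponent (A : Finset σ) : σ →₀ ℕ :=
  ∑ k ∈ A, Finsupp.single k 1

theorem squarefreeExponent_apply [DecidableEq σ] (A : Finset σ) (k : σ) :
    squarefreeExponent A k = if k ∈ A then 1 else 0 := by
  simp [squarefreeExponent, Finsupp.single_apply]

/-- The degree of a monomial in the variables `x_k` with `k ∈ Q`, as a function of its exponent. -/
noncomputable def degreeOn (Q : Finset σ) : (σ →₀ ℕ) →+ ℕ :=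
  ∑ k ∈ Q, Finsupp.applyAddHom k

theorem degreeOn_apply (Q : Finset σ) (b : σ →₀ ℕ) : degreeOn Q b = ∑ k ∈ Q, b k := by
  simp [degreeOn]

theorem degreeOn_single [DecidableEq σ] (Q : Finset σ) (k : σ) :
    degreeOn Q (Finsupp.single k 1) = if k ∈ Q then 1 else 0 := by
  simp [degreeOn_apply, Finsupp.single_apply]

theorem degreeOn_squarefreeExponent [DecidableEq σ] (Q A : Finset σ) :
    degreeOn Q (squarefreeExponent A) = #(Q ∩ A) := by
  simp [degreeOn_apply, squarefreeExponent_apply]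

variable (R) in
/-- The edge ideal of a hypergraph with edge set `E`, generated by the squarefree monomials
`∏ k ∈ A, x_k` for `A ∈ E`. -/
noncomputable def edgeIdeal (E : Set (Finset σ)) : Ideal (MvPolynomial σ R) :=
  Ideal.span ((fun A => ∏ k ∈ A, X k) '' E)

variable {E : Set (Finset σ)}

theorem monomial_squarefreeExponent_mem_edgeIdeal {A : Finset σ} (hA : A ∈ E) :
    monomial (squarefreeExponent A) 1 ∈ edgeIdeal R E := by
  rw [squarefreeExponent, monomial_sum_one]
  exact Ideal.subset_span ⟨A, hA, rfl⟩

theorem le_degreeOn_of_monomial_mem_edgeIdeal_pow [DecidableEq σ] [Nontrivial R] {t : ℕ}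
    {Q : Finset σ} (hQ : ∀ A ∈ E, (Q ∩ A).Nonempty) {b : σ →₀ ℕ}
    (hb : monomial b 1 ∈ edgeIdeal R E ^ t) : t ≤ degreeOn Q b := by
  -- Specialising the variables in `Q` to `X` and the others to `1` turns degrees in `Q` into
  -- divisibility by powers of `X`.
  let φ : MvPolynomial σ R →ₐ[R] Polynomial R :=
    aeval fun k => if k ∈ Q then Polynomial.X else 1
  have edgeIdeal_le : edgeIdeal R E ≤ (Ideal.span {Polynomial.X}).comap φ := by
    refine Ideal.span_le.2 ?_
    rintro _ ⟨A, hA, rfl⟩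
    obtain ⟨k, hk⟩ := hQ A hA
    obtain ⟨hkQ, hkA⟩ := mem_inter.1 hk
    have hφk : φ (X k) = Polynomial.X := by simp [φ, hkQ]
    rw [SetLike.mem_coe, Ideal.mem_comap, Ideal.mem_span_singleton, map_prod, ← hφk]
    exact dvd_prod_of_mem _ hkA
  have hdvd : Polynomial.X ^ t ∣ φ (monomial b 1) := by
    have hmem := (Ideal.pow_right_mono edgeIdeal_le t).trans (Ideal.le_comap_pow φ t) hb
    rwa [Ideal.mem_comap, Ideal.span_singleton_pow, Ideal.mem_span_singleton] at hmem
  have hφb : φ (monomial b 1) = Polynomial.X ^ degreeOn Q b := by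
    rw [aeval_monomial, map_one, one_mul, degreeOn_apply, ← prod_pow_eq_pow_sum, Finsupp.prod]
    simp only [ite_pow, one_pow, prod_ite_mem]
    refine prod_subset inter_subset_right fun k hkQ hk => ?_
    have hbk : b k = 0 := Finsupp.notMem_support_iff.1 fun h => hk (mem_inter.2 ⟨h, hkQ⟩)
    rw [hbk, pow_zero]
  rw [hφb, Polynomial.X_pow_dvd_iff] at hdvd
  by_contra! hlt
  simpa using hdvd _ hlt

end MonomialIdeals

theorem StanleyDecomposition.two_mul_sdepth_add_card_cover_le {σ K : Type*} [Fintype σ]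
    [DecidableEq σ] [Field K] {E : Set (Finset σ)} {t : ℕ} (ht : 1 ≤ t)
    (D : StanleyDecomposition (edgeIdeal K E ^ t)) {P : Finset σ} (hP : P.Nonempty)
    (hcover : ∀ A ∈ E, (P ∩ A).Nonempty) (hmin : ∀ k ∈ P, ∃ A ∈ E, P ∩ A = {k}) :
    2 * D.sdepth + #P ≤ 2 * Fintype.card σ + 1 := by
  obtain ⟨u, rfl⟩ := Nat.exists_eq_add_of_le ht
  obtain ⟨k₀, hk₀⟩ := hP
  obtain ⟨A₀, hA₀, hPA₀⟩ := hmin k₀ hk₀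
  let w := squarefreeExponent Pᶜ + u • squarefreeExponent A₀
  have hbound := D.two_mul_sdepth_add_sum_card_le (C := fun _ : Unit => P)
    (fun i j hij => absurd rfl hij) (fun _ => ⟨k₀, hk₀⟩) w
    (fun f hf => ?_) (fun f _ _ hmem => ?_)
  · simpa using hbound
  · rw [Fintype.sum_unique, add_right_comm]
    refine monomial_add_mem_pow ?_
      (monomial_nsmul_mem_pow (monomial_squarefreeExponent_mem_edgeIdeal hA₀) u)
    obtain ⟨A, hA, hPA⟩ := hmin _ (hf default)
    rw [pow_one]
    refine monomial_mem_of_le (monomial_squarefreeExponent_mem_edgeIdeal hA) fun k => ?_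
    have hkA : k ∈ P → k ∈ A → k = f default := fun hkP hkA =>
      mem_singleton.1 (hPA ▸ mem_inter.2 ⟨hkP, hkA⟩)
    simp only [Finsupp.add_apply, squarefreeExponent_apply, mem_compl, Finsupp.single_apply]
    grind
  · have hdeg := le_degreeOn_of_monomial_mem_edgeIdeal_pow hcover hmem
    simp [w, degreeOn_squarefreeExponent, hPA₀] at hdeg

section PathIdeal

variable {n m : ℕ}

/-- The vertices `s, s + 1, …, s + m - 1` of the path on `n` vertices. -/
def window (n m s : ℕ) : Finset (Fin n) :=
  {k | s ≤ k.val ∧ k.val < s + m}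

theorem mem_window {s : ℕ} {k : Fin n} : k ∈ window n m s ↔ s ≤ k.val ∧ k.val < s + m := by
  simp [window]

theorem pathIdeal_eq_edgeIdeal (K : Type*) [Field K] (n m : ℕ) :
    pathIdeal K n m = edgeIdeal K (window n m '' {s | s + m ≤ n}) := by
  rw [pathIdeal, edgeIdeal]
  congr 1
  ext f
  simp [window, eq_comm]

variable {K : Type*} [Field K]

theorem monomial_window_mem_pathIdeal {s : ℕ} (hs : s + m ≤ n) :
    monomial (squarefreeExponent (window n m s)) 1 ∈ pathIdeal K n m := by
  rw [pathIdeal_eq_edgeIdeal]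
  exact monomial_squarefreeExponent_mem_edgeIdeal ⟨s, hs, rfl⟩

/-- The first and the last vertices of the consecutive blocks of `m + 1` vertices. The condition
`k + m ≤ n` drops a vertex that starts no window. -/
def pathCover (n m : ℕ) : Finset (Fin n) :=
  {k | k.val % (m + 1) = 0 ∧ k.val + m ≤ n ∨ k.val % (m + 1) = m}

theorem mem_pathCover {k : Fin n} :
    k ∈ pathCover n m ↔ k.val % (m + 1) = 0 ∧ k.val + m ≤ n ∨ k.val % (m + 1) = m := by
  simp [pathCover]

theorem two_mul_div_le_card_pathCover (hm : 1 ≤ m) (n : ℕ) :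
    2 * (n / (m + 1)) ≤ #(pathCover n m) := by
  let block : Fin (n / (m + 1)) × Fin (m + 1) ↪ Fin n :=
    finProdFinEquiv.toEmbedding.trans (Fin.castLEEmb (Nat.div_mul_le_self n (m + 1)))
  have hsub : (univ ×ˢ {0, Fin.last m}).map block ⊆ pathCover n m := by
    intro k hk
    obtain ⟨⟨j, l⟩, hl, rfl⟩ := mem_map.1 hk
    have hval : (block (j, l)).val = l + (m + 1) * j := rfl
    have hj : (m + 1) * (j + 1) ≤ n :=
      (Nat.mul_le_mul_left _ j.2).trans (Nat.mul_div_le n (m + 1))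
    rw [mem_pathCover, hval, Nat.add_mul_mod_self_left]
    simp only [mem_product, mem_univ, true_and, mem_insert, mem_singleton] at hl
    rcases hl with rfl | rfl
    · left
      rw [mul_add_one] at hj
      exact ⟨Nat.zero_mod _, by rw [Fin.val_zero]; omega⟩
    · right
      simp
  have hlast : (0 : Fin (m + 1)) ≠ Fin.last m := by
    rw [ne_eq, Fin.ext_iff, Fin.val_zero, Fin.val_last]
    omega
  have hcard := card_le_card hsub
  rw [card_map, card_product, card_univ, Fintype.card_fin, card_pair hlast] at hcard
  omega

theorem pathCover_inter_window_nonempty (hm : 1 ≤ m) {s : ℕ} (hs : s + m ≤ n) :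
    (pathCover n m ∩ window n m s).Nonempty := by
  have hlt : s % (m + 1) < m + 1 := Nat.mod_lt s m.succ_pos
  by_cases hs₀ : s % (m + 1) = 0
  · exact ⟨⟨s, by omega⟩, mem_inter.2 ⟨mem_pathCover.2 (Or.inl ⟨hs₀, hs⟩),
      mem_window.2 ⟨le_rfl, Nat.lt_add_of_pos_right hm⟩⟩⟩
  · refine ⟨⟨s + (m - s % (m + 1)), by omega⟩, mem_inter.2 ⟨mem_pathCover.2 (Or.inr ?_),
      mem_window.2 ⟨Nat.le_add_right _ _, by simp only; omega⟩⟩⟩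
    rw [Nat.add_mod_eq_ite, Nat.mod_eq_of_lt (a := m - _) (by omega)]
    split_ifs <;> omega

theorem exists_pathCover_inter_window_eq_singleton {k : Fin n} (hm : 1 ≤ m)
    (hk : k ∈ pathCover n m) : ∃ s, s + m ≤ n ∧ pathCover n m ∩ window n m s = {k} := by
  suffices ∃ s, s + m ≤ n ∧ k ∈ window n m s ∧
      ∀ l ∈ pathCover n m, l ∈ window n m s → l.val = k.val by
    obtain ⟨s, hs, hkw, huniq⟩ := this
    refine ⟨s, hs, eq_singleton_iff_unique_mem.2 ⟨mem_inter.2 ⟨hk, hkw⟩, fun l hl => ?_⟩⟩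
    exact Fin.ext (huniq l (mem_inter.1 hl).1 (mem_inter.1 hl).2)
  simp only [mem_pathCover, mem_window] at hk ⊢
  rcases hk with ⟨hk, hkn⟩ | hk
  · refine ⟨k, hkn, by omega, fun l hl hlw => ?_⟩
    obtain ⟨d, hd⟩ := Nat.exists_eq_add_of_le hlw.1
    rw [hd, Nat.add_mod_eq_ite, hk, Nat.mod_eq_of_lt (a := d) (by omega)] at hl
    split_ifs at hl <;> omega
  · have hmk : m ≤ k := hk ▸ Nat.mod_le _ _
    refine ⟨k + 1 - m, by omega, by omega, fun l hl hlw => ?_⟩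
    obtain ⟨d, hd⟩ := Nat.exists_eq_add_of_le (show l.val ≤ k by omega)
    have hlt := Nat.mod_lt l.val m.succ_pos
    rw [hd, Nat.add_mod_eq_ite, Nat.mod_eq_of_lt (a := d) (by omega)] at hk
    split_ifs at hk <;> omega

theorem stanleyDepth_pathIdeal_pow_le_sub_div {t : ℕ} (hm : 1 ≤ m)
    (hmn : m ≤ n) (ht : 1 ≤ t) : stanleyDepth (pathIdeal K n m ^ t) ≤ n - n / (m + 1) := by
  rw [pathIdeal_eq_edgeIdeal]
  refine ciSup_le' fun D => ?_
  have hbound := D.two_mul_sdepth_add_card_cover_le ht (P := pathCover n m)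
    ((pathCover_inter_window_nonempty hm (s := 0) (by omega)).mono inter_subset_left)
    (by rintro _ ⟨s, hs, rfl⟩; exact pathCover_inter_window_nonempty hm hs)
    (fun k hk => by
      obtain ⟨s, hs, hsk⟩ := exists_pathCover_inter_window_eq_singleton hm hk
      exact ⟨_, ⟨s, hs, rfl⟩, hsk⟩)
  have hcard := two_mul_div_le_card_pathCover hm n
  rw [Fintype.card_fin] at hbound
  omega

/-- The vertices congruent to `i` modulo `m`. -/
def residueClass (n m i : ℕ) : Finset (Fin n) :=
  {k | k.val % m = i}

theorem mem_residueClass {i : ℕ} {k : Fin n} : k ∈ residueClass n m i ↔ k.val % m = i := by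
  simp [residueClass]

theorem card_residueClass_inter_window {i s : ℕ} (hi : i < m) (hs : s + m ≤ n) :
    #(residueClass n m i ∩ window n m s) = 1 := by
  have hmap : (residueClass n m i ∩ window n m s).map Fin.valEmbedding =
      {k ∈ Ico s (s + m) | k % m = i} := by
    ext k
    simp only [mem_map, mem_inter, mem_residueClass, mem_window, Fin.valEmbedding_apply,
      mem_filter, mem_Ico]
    exact ⟨fun ⟨l, hl, hlk⟩ => hlk ▸ hl.symm, fun hk => ⟨⟨k, by omega⟩, hk.symm, rfl⟩⟩
  have hcount : Nat.count (fun k => k % m = i) m = 1 := by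
    rw [Nat.count_eq_card_filter_range, card_eq_one]
    refine ⟨i, Finset.ext fun k => ?_⟩
    rw [mem_filter, mem_range, mem_singleton]
    exact ⟨fun ⟨hk, hki⟩ => Nat.mod_eq_of_lt hk ▸ hki, by
      rintro rfl; exact ⟨hi, Nat.mod_eq_of_lt hi⟩⟩
  rw [← card_map, hmap, Nat.filter_Ico_card_eq_of_periodic, hcount]
  intro k
  simp

theorem squarefreeExponent_window_add_single {s : ℕ} (hs : s + m < n) :
    squarefreeExponent (window n m s) + Finsupp.single ⟨s + m, hs⟩ 1 =
      squarefreeExponent (window n m (s + 1)) +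
        Finsupp.single ⟨s, (Nat.le_add_right s m).trans_lt hs⟩ 1 := by
  ext k
  simp only [Finsupp.add_apply, squarefreeExponent_apply, mem_window, Finsupp.single_apply,
    Fin.ext_iff]
  split_ifs <;> omega

theorem sum_single_eq_squarefreeExponent_window_zero {f : Fin m → Fin n}
    (hmod : ∀ i, (f i).val % m = i) (hlt : ∀ i, (f i).val < m) :
    ∑ i, Finsupp.single (f i) 1 = squarefreeExponent (window n m 0) := by
  have hval : ∀ i, (f i).val = i := fun i => Nat.mod_eq_of_lt (hlt i) ▸ hmod i
  refine sum_nbij f (fun i _ => mem_window.2 ⟨Nat.zero_le _, by simpa using hlt i⟩)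
    (fun i _ j _ hij => Fin.ext (by rw [← hval, hij, hval])) (fun k hk => ?_) fun _ _ => rfl
  have hkm : k.val < m := by simpa using (mem_window.1 hk).2
  exact ⟨⟨k, hkm⟩, mem_coe.2 (mem_univ _), Fin.ext (hval _)⟩

/- A transversal of the residue classes that uses the vertex `r + m` trades it for `r`: writing
`W_r` for the product of the variables in the window at `r`, one has `W_r x_{r+m} = W_{r+1} x_r`. -/
theorem update_mod_eq_and_update_lt {r : ℕ} {f : Fin m → Fin n}
    (hmod : ∀ l, (f l).val % m = l) (hlt : ∀ l, (f l).val < r + 1 + m) {i : Fin m}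
    (hi : (f i).val = r + m) (hr : r < n) :
    (∀ l, (Function.update f i ⟨r, hr⟩ l).val % m = l) ∧
      ∀ l, (Function.update f i ⟨r, hr⟩ l).val < r + m := by
  rw [← forall_and]
  intro l
  rcases eq_or_ne l i with rfl | hl
  · have hmodr : r % m = l := by rw [← hmod l, hi, Nat.add_mod_right]
    simpa using ⟨hmodr, l.pos⟩
  · have hne : (f l).val ≠ r + m := fun h => hl (Fin.ext (by rw [← hmod l, ← hmod i, h, hi]))
    rw [Function.update_of_ne hl]
    have := hlt l
    exact ⟨hmod l, by omega⟩

theorem exists_mem_pathIdeal_pow_windows_add_eq {r : ℕ} (hr : r + m ≤ n)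
    {f : Fin m → Fin n} (hmod : ∀ i, (f i).val % m = i) (hlt : ∀ i, (f i).val < r + m) :
    ∃ b, monomial b 1 ∈ pathIdeal K n m ^ r ∧
      ∑ s ∈ range r, squarefreeExponent (window n m (s + 1)) + ∑ i, Finsupp.single (f i) 1 =
        b + squarefreeExponent (window n m r) := by
  induction r generalizing f with
  | zero =>
    refine ⟨0, by simp, ?_⟩
    rw [sum_range_zero, sum_single_eq_squarefreeExponent_window_zero hmod (by simpa using hlt)]
  | succ r ih =>
    have extend : ∀ {b s}, monomial b 1 ∈ pathIdeal K n m ^ r → s + m ≤ n →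
        monomial (b + squarefreeExponent (window n m s)) 1 ∈ pathIdeal K n m ^ (r + 1) :=
      fun hb hs => monomial_add_mem_pow hb ((pow_one (pathIdeal K n m)).symm ▸
        monomial_window_mem_pathIdeal hs)
    by_cases htop : ∃ i, (f i).val = r + m
    · obtain ⟨i, hi⟩ := htop
      have hrn : r < n := by omega
      have hi' : f i = ⟨r + m, by omega⟩ := Fin.ext hi
      obtain ⟨hmod', hlt'⟩ := update_mod_eq_and_update_lt hmod hlt hi hrn
      obtain ⟨b, hb, hsum⟩ := ih (by omega) hmod' hlt'
      refine ⟨_, extend hb hr, add_right_cancel (b := Finsupp.single ⟨r, hrn⟩ 1) ?_⟩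
      have hslide := squarefreeExponent_window_add_single (n := n) (m := m) (s := r) (by omega)
      have hswap := sum_update_add (fun k => Finsupp.single k 1) f i ⟨r, hrn⟩
      rw [hi'] at hswap
      rw [sum_range_succ, add_assoc, ← hswap, add_assoc _ _ (Finsupp.single _ 1), ← hslide,
        add_add_add_comm, ← add_assoc, hsum]
      abel
    · obtain ⟨b, hb, hsum⟩ := ih (by omega) hmod fun i => by
        have := hlt i
        have : (f i).val ≠ r + m := fun h => htop ⟨i, h⟩
        omega
      refine ⟨_, extend (s := r) hb (by omega), ?_⟩
      rw [sum_range_succ, add_right_comm, hsum]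

theorem monomial_windows_add_mem_pathIdeal_pow {r : ℕ}
    (hr : r + 1 + m ≤ n) {f : Fin m → Fin n} (hmod : ∀ i, (f i).val % m = i)
    (hlt : ∀ i, (f i).val < r + 1 + m) :
    monomial (∑ s ∈ range r, squarefreeExponent (window n m (s + 1)) +
      ∑ i, Finsupp.single (f i) 1) 1 ∈ pathIdeal K n m ^ (r + 1) := by
  obtain ⟨b, hb, hsum⟩ := exists_mem_pathIdeal_pow_windows_add_eq (K := K) hr hmod hlt
  rw [sum_range_succ, add_right_comm] at hsum
  rwa [add_right_cancel hsum]

theorem monomial_windows_add_erase_notMem_pathIdeal_pow {r u : ℕ}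
    (hr : r + m ≤ n) {f : Fin m → Fin n} (hmod : ∀ i, (f i).val % m = i) (i : Fin m) :
    monomial (∑ s ∈ range r, squarefreeExponent (window n m (s + 1)) +
      u • squarefreeExponent (window n m 0) + ∑ l ∈ univ.erase i, Finsupp.single (f l) 1) 1 ∉
        pathIdeal K n m ^ (r + 1 + u) := by
  intro hmem
  rw [pathIdeal_eq_edgeIdeal] at hmem
  have hdeg := le_degreeOn_of_monomial_mem_edgeIdeal_pow (Q := residueClass n m i)
    (by
      rintro _ ⟨s, hs, rfl⟩
      exact card_pos.1 (card_residueClass_inter_window i.2 hs ▸ one_pos)) hmem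
  have hwindows : ∑ s ∈ range r, degreeOn (residueClass n m i)
      (squarefreeExponent (window n m (s + 1))) = r := by
    rw [sum_congr rfl fun s hs => ?_, sum_const, card_range, smul_eq_mul, mul_one]
    rw [degreeOn_squarefreeExponent, card_residueClass_inter_window i.2]
    have := mem_range.1 hs
    omega
  have herase : ∑ l ∈ univ.erase i, degreeOn (residueClass n m i) (Finsupp.single (f l) 1) = 0 :=
    sum_eq_zero fun l hl => by
      rw [degreeOn_single, if_neg]
      rw [mem_residueClass, hmod]
      exact fun h => ne_of_mem_erase hl (Fin.ext h)
  rw [map_add, map_add, map_sum, map_sum, map_nsmul, hwindows, herase,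
    degreeOn_squarefreeExponent, card_residueClass_inter_window i.2 (by omega)] at hdeg
  simp only [smul_eq_mul] at hdeg
  omega

theorem sum_card_filter_residueClass {N : ℕ} (hm : 1 ≤ m) (hN : N ≤ n) :
    ∑ i : Fin m, #{k ∈ residueClass n m i | k.val < N} = N := by
  calc ∑ i : Fin m, #{k ∈ residueClass n m i | k.val < N}
      = ∑ i : Fin m, #{k ∈ ({k | k.val < N} : Finset (Fin n)) |
          (⟨k.val % m, Nat.mod_lt _ hm⟩ : Fin m) = i} := by
        simp only [residueClass, filter_filter, Fin.ext_iff, and_comm]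
    _ = #({k | k.val < N} : Finset (Fin n)) :=
        (card_eq_sum_card_fiberwise fun _ _ => mem_coe.2 (mem_univ _)).symm
    _ = N := by rw [Fin.card_filter_val_lt, min_eq_right hN]

theorem two_mul_sdepth_pathIdeal_pow_add_le {r u : ℕ} (hm : 1 ≤ m)
    (hr : r + 1 + m ≤ n) (D : StanleyDecomposition (pathIdeal K n m ^ (r + 1 + u))) :
    2 * D.sdepth + (r + 1) ≤ 2 * n := by
  let C : Fin m → Finset (Fin n) := fun i => {k ∈ residueClass n m i | k.val < r + 1 + m}
  have hC : ∀ {i k}, k ∈ C i ↔ k.val % m = i ∧ k.val < r + 1 + m := fun {i k} => by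
    simp only [C, mem_filter, mem_residueClass]
  have hdisj : Pairwise (Function.onFun Disjoint C) := fun i j hij =>
    disjoint_left.2 fun k hki hkj => hij (Fin.ext ((hC.1 hki).1.symm.trans (hC.1 hkj).1))
  have hne : ∀ i, (C i).Nonempty := fun i =>
    ⟨⟨i, by omega⟩, hC.2 ⟨Nat.mod_eq_of_lt i.2, by simp only; omega⟩⟩
  have hbound := D.two_mul_sdepth_add_sum_card_le hdisj hne
    (∑ s ∈ range r, squarefreeExponent (window n m (s + 1)) +
      u • squarefreeExponent (window n m 0))
    (fun f hf => by
      rw [add_right_comm (∑ _ ∈ _, _)]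
      exact monomial_add_mem_pow
        (monomial_windows_add_mem_pathIdeal_pow hr (fun i => (hC.1 (hf i)).1)
          fun i => (hC.1 (hf i)).2)
        (monomial_nsmul_mem_pow (monomial_window_mem_pathIdeal (by omega)) u))
    (fun f hf i => monomial_windows_add_erase_notMem_pathIdeal_pow (by omega)
      (fun l => (hC.1 (hf l)).1) i)
  rw [sum_card_filter_residueClass hm hr, Fintype.card_fin, Fintype.card_fin] at hbound
  omega

theorem stanleyDepth_pathIdeal_pow_le_sub_half {t t₀ : ℕ} (hm : 1 ≤ m)
    (ht₀ : 1 ≤ t₀) (ht : t₀ ≤ t) (hn : t₀ + m ≤ n) :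
    stanleyDepth (pathIdeal K n m ^ t) ≤ n - (t₀ + 1) / 2 := by
  obtain ⟨r, rfl⟩ := Nat.exists_eq_add_of_le' ht₀
  obtain ⟨u, rfl⟩ := Nat.exists_eq_add_of_le ht
  refine ciSup_le' fun D => ?_
  have hbound := two_mul_sdepth_pathIdeal_pow_add_le hm hn D
  omega

end PathIdeal

theorem floor_sub_add_one_div_le {F : Type*} [Field F] [LinearOrder F] [IsStrictOrderedRing F]
    [FloorRing F] (x : F) {y z : F} (hy : 0 ≤ y) (hz : 0 ≤ z) :
    ⌊(x - y + 1) / (z + 1)⌋ ≤ ⌊x / (z + 1)⌋ + 1 := by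
  have hz' : 0 < z + 1 := by linarith
  rw [← Int.floor_add_one, div_add_one hz'.ne']
  exact Int.floor_mono (div_le_div_of_nonneg_right (by linarith) hz'.le)

theorem theorem4p3_general (K : Type*) [Field K] (n m t t₀ : ℕ) (hm : 1 ≤ m) (hmn : m ≤ n)
    (ht : 1 ≤ t) (ht₀ : t₀ = min t (n - m)) :
    (stanleyDepth (pathIdeal K n m ^ t) : ℤ) ≤
      min ((n : ℤ) - ⌈(t₀ : ℚ) / 2⌉) ((n : ℤ) - ⌊(n : ℚ) / ((m : ℚ) + 1)⌋) := by
  have hdiv := stanleyDepth_pathIdeal_pow_le_sub_div (K := K) hm hmn ht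
  refine le_min ?_ ?_
  · have hceil : ⌈(t₀ : ℚ) / 2⌉ ≤ ((t₀ + 1) / 2 : ℕ) := by
      rw [Int.ceil_le, div_le_iff₀ two_pos]
      exact_mod_cast (by omega : t₀ ≤ (t₀ + 1) / 2 * 2)
    have hhalf : stanleyDepth (pathIdeal K n m ^ t) ≤ n - (t₀ + 1) / 2 := by
      rcases t₀.eq_zero_or_pos with rfl | hpos
      · exact hdiv.trans (Nat.sub_le_sub_left (Nat.zero_le _) n)
      · exact stanleyDepth_pathIdeal_pow_le_sub_half hm hpos (by omega) (by omega)
    omega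
  · have hfloor : ⌊(n : ℚ) / ((m : ℚ) + 1)⌋ = (n / (m + 1) : ℕ) := by
      exact_mod_cast Rat.floor_natCast_div_natCast n (m + 1)
    have := Nat.div_le_self n (m + 1)
    omega

theorem theorem4p3 (K : Type*) [Field K] (n m t t₀ : ℕ) (hm : 1 ≤ m) (hmn : m ≤ n) (ht : 1 ≤ t)
    (ht₀ : t₀ = min t (n - m)) :
    (stanleyDepth (pathIdeal K n m ^ t) : ℤ) ≤
      min ((n : ℤ) - ⌈(t₀ : ℚ) / 2⌉)
        ((n : ℤ) - ⌊((n : ℚ) - (t₀ : ℚ) + 1) / ((m : ℚ) + 1)⌋ + 1) := by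
  refine (theorem4p3_general K n m t t₀ hm hmn ht ht₀).trans (min_le_min_left _ ?_)
  linarith [floor_sub_add_one_div_le (n : ℚ) t₀.cast_nonneg m.cast_nonneg]
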